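/- For integers $r,s\ge 0$ with $r+s\ge 1$ and $n=2(r+s)$, let $\mathrm{Cay}(\mathbb{Z}_4^n,(r,s,r,s))$ be the graph with vertex set $\mathbb{Z}_4^n$ in which $v,w$ are adjacent if and only if, among the coordinates of $v-w$, the symbols $0$ and $2$ each occur exactly $r$ times and the symbols $1$ and $3$ each occur exactly $s$ times. For a graph $G$ with vertex set $V$, a quantum $c$-coloring of $G$ is a collection of orthogonal projections $P_{v,i}:\mathbb{C}^d\to\mathbb{C}^d$ ($v\in V$, $1\le i\le c$), for some $d\ge 1$, such that $\sum_{i=1}^{c}P_{v,i}=I_d$ for every $v\in V$, and $P_{v,i}P_{w,i}=0$ for all adjacent $v,w$ and all $i$; the quantum chromatic number $\chi_q(G)$ is the smallest $c$ for which $G$ admits a quantum $c$-coloring. Let $n=2(r+s)$ with $r\ge s$ and $r$ even. Then $$\chi_q\bigl(\mathrm{Cay}(\mathbb{Z}_4^n,(r,s,r,s))\bigr)=n$$ in both of the following regimes: (R1) $s\ge 2$ is fixed and $n$ is large enough; that is, for every $s\ge 2$ there is an $N=N(s)$ such that the equality holds for all such $r$ and $n$ with $n\ge N$. (R2) $s=\alpha\cdot\frac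 n2$ with $0<\alpha\le 0.17$ and $n$ is large enough; that is, there is an absolute constant $N$ such that the equality holds for all real $\alpha\in(0,0.17]$ and all such $r,s,n$ with $s=\alpha n/2$ and $n\ge N$. -/

import Mathlib

/-- The `k`-th Hamming weight of `v ∈ ℤ₄ⁿ`: the number of coordinates equal to `k`. -/
def hammingWt {n : ℕ} (k : ZMod 4) (v : Fin n → ZMod 4) : ℕ :=
  (Finset.univ.filter fun i => v i = k).card

/-- The set of vectors of type `(t₀, t₁, t₂, t₃)` in `ℤ₄ⁿ`, i.e. of those in which the symbol `k`
occurs exactly `t_k` times. -/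
def vectorsOfType (n t₀ t₁ t₂ t₃ : ℕ) : Set (Fin n → ZMod 4) :=
  {v | hammingWt 0 v = t₀ ∧ hammingWt 1 v = t₁ ∧ hammingWt 2 v = t₂ ∧ hammingWt 3 v = t₃}

/-- The Cayley graph of the additive group `ℤ₄ⁿ` generated by the vectors of type `(r, s, r, s)`.
This set is closed under negation and, unless `n = 0`, does not contain `0`, so that for `n > 0`
two vertices `v`, `w` are adjacent in `addCayley` exactly when `v - w` is of this type. -/
def cayleyZ4 (n r s : ℕ) : SimpleGraph (Fin n → ZMod 4) :=
  SimpleGraph.addCayley (vectorsOfType n r s r s)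

/-- A quantum `c`-coloring of `G` on `ℂᵈ`, `d ≥ 1`: orthogonal projections `P v i` (self-adjoint
idempotent matrices), for vertices `v` and colors `i`, that sum to the identity at each vertex and
satisfy `P v i * P w i = 0` for adjacent `v`, `w`. -/
structure QuantumColoring {V : Type*} (G : SimpleGraph V) (c d : ℕ) where
  /-- The dimension is positive: `ℂ⁰` would color every graph with no colors. -/
  dim_pos : 0 < d
  P : V → Fin c → Matrix (Fin d) (Fin d) ℂ
  isStarProjection : ∀ v i, IsStarProjection (P v i)
  sum_eq_one : ∀ v, ∑ i, P v i = 1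
  mul_eq_zero : ∀ v w, G.Adj v w → ∀ i, P v i * P w i = 0

/-- `G` admits a quantum `c`-coloring in some positive finite dimension. -/
def QuantumColorable {V : Type*} (G : SimpleGraph V) (c : ℕ) : Prop :=
  ∃ d : ℕ, Nonempty (QuantumColoring G c d)

/-- The quantum chromatic number: the smallest `c` such that `G` admits a quantum `c`-coloring
(`⊤` if there is none). -/
noncomputable def quantumChromaticNumber {V : Type*} (G : SimpleGraph V) : ℕ∞ :=
  ⨅ c : {c : ℕ // QuantumColorable G c}, ((c : ℕ) : ℕ∞)

/-! Upper bound: multiply the Fourier basis of `ℂⁿ` entrywise by the phases `i^(v_a)` of a vertex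
`v`. For adjacent `v`, `w` the phases of `v - w` sum to `r(1 - 1) + s(i - i) = 0`, so equal colors
get orthogonal vectors.

Lower bound: the Hoffman bound holds for quantum colorings, so it suffices that every eigenvalue `∑
v ∈ S, ψ v` of the Cayley graph, `S` the connection set, has real part at least `-|S|/(n - 1)`. Let
`k` be the number of coordinates with `ψ(e_j)² = -1`.

If `0 < k < n`, write `v = 1_T + 2·1_W` and sum over `W` first. Each inner sum is a product of two
middle-degree Krawtchouk numbers, whose sign does not depend on `T`. The triangle inequality over
`T` therefore produces a single middle Krawtchouk number, small enough by `kraw_middle_abs_le`.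

If `k = 0` or `k = n`, the eigenvalue is a positive multiple of a Krawtchouk number of degree `2s`
(evenness of `r` fixes the sign when `k = n`). What remains is `exists_neg_choose_le_kraw`: for even
`t ≤ 0.17 n` and large `n`, Krawtchouk numbers of degree `t` are at least `-C(n,t)/(n - 1)`. They
are nonnegative away from the center `k = n/2`; near it, orthogonality and entropy bounds make them
small. Degrees 2 and 4 are computed explicitly. -/

open Polynomial in
/-- The value at `k` of the Krawtchouk polynomial of degree `t` on the hypercube of dimension `n`,
for `k ≤ n`. -/
noncomputable def kraw (n k t : ℕ) : ℤ :=
  ((1 - X) ^ k * (1 + X) ^ (n - k) : ℤ[X]).coeff t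

/-! ### Krawtchouk numbers: recurrences, orthogonality, middle degree -/

section Krawtchouk

open Polynomial

theorem kraw_zero (n t : ℕ) : kraw n 0 t = n.choose t := by
  simp [kraw, coeff_one_add_X_pow]

theorem kraw_one (n t : ℕ) : ((n + 1 : ℕ) : ℤ) * kraw (n + 1) 1 t
    = ((n + 1 : ℕ) - 2 * t : ℤ) * kraw (n + 1) 0 t := by
  have h : (2 * X * derivative ((1 + X) ^ (n + 1)) : ℤ[X])
      = C ((n + 1 : ℕ) : ℤ) * ((1 + X) ^ (n + 1) - (1 - X) ^ 1 * (1 + X) ^ n) := by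
    simp only [derivative_pow, derivative_add, derivative_one, derivative_X]
    simp
    ring
  have h2 := congrArg (fun p => p.coeff t) h
  simp only [coeff_C_mul, coeff_sub] at h2
  have h3 : (2 * X * derivative ((1 + X) ^ (n + 1)) : ℤ[X]).coeff t
      = 2 * t * ((1 + X) ^ (n + 1) : ℤ[X]).coeff t := by
    rw [mul_assoc, show (2 : ℤ[X]) = C 2 by simp, coeff_C_mul]
    cases t with
    | zero => simp
    | succ t => rw [coeff_X_mul, coeff_derivative]; push_cast; ring
  rw [h3] at h2
  simp only [kraw, pow_zero, one_mul, Nat.sub_zero, Nat.add_sub_cancel]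
  linarith

/-- Compare coefficients in `2X·p'` for `p = (1 - X)^(k+1) (1 + X)^(m+1)`, using `2X = (1 + X) - (1
- X)`. -/
theorem kraw_rec (m k t : ℕ) : ((m + 1 : ℕ) : ℤ) * kraw (k + 2 + m) (k + 2) t
    = ((k + 2 + m : ℕ) - 2 * t : ℤ) * kraw (k + 2 + m) (k + 1) t
      - ((k + 1 : ℕ) : ℤ) * kraw (k + 2 + m) k t := by
  have h : (2 * X * derivative ((1 - X) ^ (k + 1) * (1 + X) ^ (m + 1)) : ℤ[X])
      = - C ((k + 1 : ℕ) : ℤ) * ((1 - X) ^ k * (1 + X) ^ (m + 2))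
        + C ((k + 2 + m : ℕ) : ℤ) * ((1 - X) ^ (k + 1) * (1 + X) ^ (m + 1))
        - C ((m + 1 : ℕ) : ℤ) * ((1 - X) ^ (k + 2) * (1 + X) ^ m) := by
    simp only [derivative_mul, derivative_pow, derivative_add, derivative_sub, derivative_one,
      derivative_X]
    simp
    ring
  have h2 := congrArg (fun p => p.coeff t) h
  simp only [coeff_C_mul, coeff_sub, coeff_add, ← C_neg] at h2
  have h3 : (2 * X * derivative ((1 - X) ^ (k + 1) * (1 + X) ^ (m + 1)) : ℤ[X]).coeff t
      = 2 * t * ((1 - X) ^ (k + 1) * (1 + X) ^ (m + 1) : ℤ[X]).coeff t := by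
    rw [mul_assoc, show (2 : ℤ[X]) = C 2 by simp, coeff_C_mul]
    cases t with
    | zero => simp
    | succ t => rw [coeff_X_mul, coeff_derivative]; push_cast; ring
  rw [h3] at h2
  simp only [kraw, show k + 2 + m - (k + 2) = m by omega, show k + 2 + m - (k + 1) = m + 1 by omega,
    show k + 2 + m - k = m + 2 by omega]
  linarith

theorem kraw_symm {n k : ℕ} (hk : k ≤ n) (t : ℕ) :
    kraw n (n - k) t = (-1) ^ t * kraw n k t := by
  have h : ((1 - X) ^ (n - k) * (1 + X) ^ k : ℤ[X])
      = ((1 - X) ^ k * (1 + X) ^ (n - k) : ℤ[X]).comp (-X) := by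
    simp [mul_comp, pow_comp, mul_comm, ← sub_eq_add_neg]
  rw [kraw, kraw, Nat.sub_sub_self hk, h, show (-X : ℤ[X]) = C (-1) * X by simp, comp_C_mul_X_coeff,
    mul_comm]

/-- Coefficients of the differential equation `(1 - X²) p' = ((m - k) - (k + m) X) p` for `p = (1 -
X)^k (1 + X)^m`. -/
theorem kraw_rec_degree (k m t : ℕ) : ((t + 2 : ℕ) : ℤ) * kraw (k + m) k (t + 2)
    = ((m : ℤ) - k) * kraw (k + m) k (t + 1) - ((k : ℤ) + m - t) * kraw (k + m) k t := by
  have h : (derivative ((1 - X) ^ k * (1 + X) ^ m) * (1 - X ^ 2) : ℤ[X])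
      = ((1 - X) ^ k * (1 + X) ^ m) * (C ((m : ℤ) - k) - C ((k : ℤ) + m) * X) := by
    cases k <;> cases m <;>
      simp [derivative_mul, derivative_pow] <;> ring
  have h2 := congrArg (fun p => p.coeff (t + 1)) h
  rw [mul_sub, mul_sub] at h2
  simp only [coeff_sub, mul_one, coeff_derivative, coeff_mul_C, ← mul_assoc, coeff_mul_X] at h2
  have h3 : (derivative ((1 - X) ^ k * (1 + X) ^ m) * X ^ 2 : ℤ[X]).coeff (t + 1)
      = t * ((1 - X) ^ k * (1 + X) ^ m : ℤ[X]).coeff t := by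
    cases t with
    | zero => simp [pow_two, ← mul_assoc, mul_coeff_zero]
    | succ t =>
      rw [show t + 1 + 1 = t + 2 by omega, coeff_mul_X_pow, coeff_derivative]; push_cast; ring
  rw [h3] at h2
  simp only [kraw, Nat.add_sub_cancel_left]
  push_cast at h2 ⊢
  rw [show t + 1 + 1 = t + 2 by omega] at h2
  linarith

theorem kraw_degree_zero (n k : ℕ) : kraw n k 0 = 1 := by
  simp [kraw, coeff_zero_eq_eval_zero]

theorem kraw_degree_one (k m : ℕ) : kraw (k + m) k 1 = (m : ℤ) - k := by
  have h : kraw (k + m) k 1 = (derivative ((1 - X) ^ k * (1 + X) ^ m) : ℤ[X]).coeff 0 := by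
    rw [coeff_derivative, kraw, Nat.add_sub_cancel_left]; simp
  rw [h, coeff_zero_eq_eval_zero]
  simp [derivative_mul, derivative_pow]
  ring

/-- One term of the orthogonality relation `∑ j, C(n,j) K_t(j)² = 2^n C(n,t)`. That relation is the
coefficient of `X^t Y^t` in `((1 - X)(1 - Y) + (1 + X)(1 + Y))^n = 2^n (1 + XY)^n`. -/
theorem choose_mul_kraw_sq_le {n k : ℕ} (hk : k ≤ n) (t : ℕ) :
    (n.choose k : ℤ) * kraw n k t ^ 2 ≤ 2 ^ n * n.choose t := by
  have h : ∑ j ∈ Finset.range (n + 1), (n.choose j : ℤ) * kraw n j t ^ 2 = 2 ^ n * n.choose t := by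
    have key : ∑ j ∈ Finset.range (n + 1), (n.choose j : ℤ[X][X]) *
        (C ((1 - X) ^ j * (1 + X) ^ (n - j)) * ((1 - X) ^ j * (1 + X) ^ (n - j) : ℤ[X]).map C)
        = C (C (2 ^ n)) * ((1 + X) ^ n : ℤ[X][X]).comp (C X * X) := by
      have e : ((1 + X) ^ n : ℤ[X][X]).comp (C X * X) = (1 + C X * X) ^ n := by simp
      have e2 : (C (C (2 ^ n)) : ℤ[X][X]) * (1 + C X * X) ^ n
          = (C (1 - X) * (1 - X) + C (1 + X) * (1 + X)) ^ n := by
        have : (C (1 - X) * (1 - X) + C (1 + X) * (1 + X) : ℤ[X][X]) = 2 * (1 + C X * X) := by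
          simp; ring
        rw [this, mul_pow, C_pow, C_pow]; rfl
      rw [e, e2, add_pow]
      refine Finset.sum_congr rfl fun j _ => ?_
      simp only [Polynomial.map_mul, Polynomial.map_pow, Polynomial.map_sub, Polynomial.map_one,
        Polynomial.map_X, Polynomial.map_add, C_mul, C_pow, mul_pow]
      ring
    have k2 := congrArg (fun p => (p.coeff t).coeff t) key
    simp only [finsetSum_coeff, coeff_C_mul, comp_C_mul_X_coeff, coeff_one_add_X_pow,
      ← C_eq_natCast, coeff_map, coeff_mul_C, coeff_X_pow_self, mul_one] at k2
    rw [← k2]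
    refine Finset.sum_congr rfl fun j _ => ?_
    rw [kraw, pow_two]
  rw [← h]
  exact Finset.single_le_sum (f := fun j => (n.choose j : ℤ) * kraw n j t ^ 2)
    (fun j _ => by positivity) (Finset.mem_range.2 (by omega))

/-- The left side is the coefficient of `X^t` in `∏ (1 + ε_j X)`, which depends only on the number
of minus signs. -/
theorem sum_powersetCard_prod {ι : Type*} [DecidableEq ι] (A : Finset ι) (ε : ι → ℤ)
    (hε : ∀ j ∈ A, ε j = 1 ∨ ε j = -1) (t : ℕ) :
    ∑ U ∈ A.powersetCard t, ∏ j ∈ U, ε j = kraw A.card (A.filter fun j => ε j = -1).card t := by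
  have h1 : ∏ j ∈ A, (1 + C (ε j) * X) = (1 - X) ^ (A.filter fun j => ε j = -1).card
      * (1 + X) ^ (A.card - (A.filter fun j => ε j = -1).card) := by
    rw [← Finset.prod_filter_mul_prod_filter_not A (fun j => ε j = -1)]
    congr 1
    · rw [Finset.prod_congr rfl (g := fun _ => (1 - X : ℤ[X])), Finset.prod_const]
      intro j hj
      rw [(Finset.mem_filter.1 hj).2]; simp [sub_eq_add_neg]
    · rw [Finset.prod_congr rfl (g := fun _ => (1 + X : ℤ[X])), Finset.prod_const]
      · congr 1
        have := Finset.card_filter_add_card_filter_not (s := A) (fun j => ε j = -1)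
        omega
      · intro j hj
        have := Finset.mem_filter.1 hj
        rw [(hε j this.1).resolve_right this.2]; simp
  rw [kraw, ← h1, Finset.prod_one_add, finsetSum_coeff,
    ← Finset.sum_filter_add_sum_filter_not A.powerset (fun U => U.card = t)]
  rw [Finset.sum_eq_zero (s := A.powerset.filter fun U => ¬ U.card = t), add_zero]
  · rw [← Finset.powersetCard_eq_filter]
    refine Finset.sum_congr rfl fun U hU => ?_
    rw [Finset.prod_mul_distrib, Finset.prod_const, (Finset.mem_powersetCard.1 hU).2, ← map_prod,
      coeff_C_mul_X_pow, if_pos rfl]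
  · intro U hU
    rw [Finset.prod_mul_distrib, Finset.prod_const, ← map_prod, coeff_C_mul_X_pow, if_neg]
    exact fun h => (Finset.mem_filter.1 hU).2 h.symm

/-- At `t = n/2` the factor `n - 2t` kills the middle term of `kraw_rec`, so the recurrence moves in
steps of two and alternates in sign. -/
theorem kraw_middle_rec (m k : ℕ) (hk : k + 2 ≤ 2 * m) :
    ((2 * m : ℕ) - (k + 1) : ℤ) * kraw (2 * m) (k + 2) m = - ((k + 1) * kraw (2 * m) k m) := by
  obtain ⟨l, hl⟩ := Nat.exists_eq_add_of_le hk
  have := kraw_rec l k m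
  rw [← hl] at this
  have h2 : ((2 * m : ℕ) : ℤ) = k + 2 + l := by rw [hl]; push_cast; ring
  push_cast at this h2 ⊢
  linear_combination this + kraw (2 * m) (k + 2) m * h2

theorem kraw_middle_odd (m j : ℕ) (hj : 2 * j + 1 ≤ 2 * m) : kraw (2 * m) (2 * j + 1) m = 0 := by
  induction j with
  | zero =>
    obtain ⟨l, rfl⟩ : ∃ l, m = l + 1 := ⟨m - 1, by omega⟩
    have := kraw_one (2 * l + 1) (l + 1)
    rw [show ((2 * l + 1 + 1 : ℕ) - 2 * (l + 1 : ℕ) : ℤ) = 0 by push_cast; ring, zero_mul] at this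
    exact (mul_eq_zero.1 this).resolve_left (by positivity)
  | succ j ih =>
    have := kraw_middle_rec m (2 * j + 1) (by omega)
    rw [ih (by omega)] at this
    simp only [mul_zero, neg_zero] at this
    refine (mul_eq_zero.1 this).resolve_left ?_
    omega

theorem kraw_middle_even_nonneg (m j : ℕ) (hj : 2 * j ≤ 2 * m) :
    0 ≤ (-1) ^ j * kraw (2 * m) (2 * j) m := by
  induction j with
  | zero => simp [kraw_zero]
  | succ j ih =>
    have h := kraw_middle_rec m (2 * j) (by omega)
    have ih := ih (by omega)
    have hp : (0 : ℤ) < (2 * m : ℕ) - ((2 * j : ℕ) + 1) := by push_cast; omega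
    refine nonneg_of_mul_nonneg_right (a := ((2 * m : ℕ) - ((2 * j : ℕ) + 1) : ℤ)) ?_ hp
    calc (0 : ℤ) ≤ ((2 * j : ℕ) + 1) * ((-1) ^ j * kraw (2 * m) (2 * j) m) := by positivity
      _ = _ := by
        rw [show 2 * (j + 1) = 2 * j + 2 by ring, pow_succ]
        linear_combination (-1) ^ j * h

/-- Equality holds at `k = 2`; the absolute values at even `k` then do not increase up to the
middle, odd ones vanish, and `kraw_symm` covers the other half. -/
theorem kraw_middle_abs_le {m k : ℕ} (hk : 0 < k) (hk' : k < 2 * m) :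
    (2 * m - 1 : ℤ) * |kraw (2 * m) k m| ≤ (2 * m).choose m := by
  have half : ∀ j : ℕ, j + 1 ≤ m → 2 * (j + 1) ≤ m + 1 →
      (2 * m - 1 : ℤ) * |kraw (2 * m) (2 * (j + 1)) m| ≤ (2 * m).choose m := by
    intro j
    induction j with
    | zero =>
      intro h1 _
      have h := kraw_middle_rec m 0 (by omega)
      rw [kraw_zero] at h
      have h' : (2 * m - 1 : ℤ) * kraw (2 * m) 2 m = - (2 * m).choose m := by
        push_cast at h; linarith
      have := congrArg abs h'
      rw [abs_mul, abs_neg, Nat.abs_cast, abs_of_nonneg (by omega : (0 : ℤ) ≤ 2 * m - 1)] at this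
      exact this.le
    | succ j ih =>
      intro h1 h2
      have ih := ih (by omega) (by omega)
      have h := congrArg abs (kraw_middle_rec m (2 * (j + 1)) (by omega))
      rw [abs_mul, abs_neg, abs_mul,
        abs_of_pos (by push_cast; omega : (0 : ℤ) < (2 * m : ℕ) - ((2 * (j + 1) : ℕ) + 1)),
        abs_of_pos (by positivity : (0 : ℤ) < (2 * (j + 1) : ℕ) + 1)] at h
      have hle : |kraw (2 * m) (2 * (j + 1) + 2) m| ≤ |kraw (2 * m) (2 * (j + 1)) m| := by
        have hp : (0 : ℤ) < (2 * m : ℕ) - ((2 * (j + 1) : ℕ) + 1) := by push_cast; omega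
        refine le_of_mul_le_mul_left ?_ hp
        rw [h]
        exact mul_le_mul_of_nonneg_right (by push_cast; omega) (abs_nonneg _)
      refine le_trans ?_ ih
      exact mul_le_mul_of_nonneg_left hle (by omega)
  rcases Nat.even_or_odd' k with ⟨j, rfl | rfl⟩
  · by_cases h : 2 * j ≤ m + 1
    · obtain ⟨i, rfl⟩ : ∃ i, j = i + 1 := ⟨j - 1, by omega⟩
      exact half i (by omega) h
    · have h1 := half (m - j - 1) (by omega) (by omega)
      rw [show 2 * (m - j - 1 + 1) = 2 * m - 2 * j by omega, kraw_symm (by omega), abs_mul,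
        abs_pow, abs_neg, abs_one, one_pow, one_mul] at h1
      exact h1
  · rw [kraw_middle_odd m j (by omega)]
    simp

end Krawtchouk

/-- Induction along `kraw_rec` on the ratio bound `K(j+1) ≥ g K(j)`. The hypothesis is the
discriminant condition of `(n - k) x² - (n - 2t) x + k`, and `g` is the geometric mean of its roots.
-/
theorem kraw_nonneg {n k t : ℕ} (hk : 2 * k ≤ n) (ht : 2 * t ≤ n)
    (h : 4 * (k : ℝ) * (n - k) ≤ (n - 2 * t) ^ 2) : 0 ≤ kraw n k t := by
  rcases Nat.eq_zero_or_pos k with rfl | hk0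
  · rw [kraw_zero]; positivity
  have hkR : (0 : ℝ) < k := by exact_mod_cast hk0
  have hknR : 2 * (k : ℝ) ≤ n := by exact_mod_cast hk
  have htR : 2 * (t : ℝ) ≤ n := by exact_mod_cast ht
  have hnk : (0 : ℝ) < n - k := by linarith
  obtain ⟨g, hg0, hg⟩ : ∃ g : ℝ, 0 < g ∧ g ^ 2 * (n - k) = k := by
    refine ⟨√(k / (n - k)), Real.sqrt_pos.2 (div_pos hkR hnk), ?_⟩
    rw [Real.sq_sqrt (div_pos hkR hnk).le, div_mul_cancel₀ _ hnk.ne']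
  have hg1 : g ^ 2 ≤ 1 := by
    by_contra! hlt
    nlinarith
  have hg2 : 2 * (k : ℝ) ≤ g * (n - 2 * t) := by
    refine le_of_sq_le_sq ?_ (mul_nonneg hg0.le (by linarith))
    calc (2 * (k : ℝ)) ^ 2 = g ^ 2 * (4 * k * (n - k)) := by linear_combination -4 * (k : ℝ) * hg
      _ ≤ g ^ 2 * (n - 2 * t) ^ 2 := by gcongr
      _ = _ := by ring
  have key : ∀ j : ℕ, j + 1 ≤ k →
      0 ≤ (kraw n j t : ℝ) ∧ g * kraw n j t ≤ (kraw n (j + 1) t : ℝ) := by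
    intro j
    induction j with
    | zero =>
      intro _
      have h0 : 0 ≤ (kraw n 0 t : ℝ) := by rw [kraw_zero]; positivity
      refine ⟨h0, ?_⟩
      obtain ⟨m, rfl⟩ : ∃ m, n = m + 1 := ⟨n - 1, by omega⟩
      have h1 : ((m + 1 : ℕ) : ℝ) * kraw (m + 1) 1 t
          = ((m + 1 : ℕ) - 2 * t : ℝ) * kraw (m + 1) 0 t := by exact_mod_cast kraw_one m t
      have h2 : g * (m + 1 : ℕ) ≤ (m + 1 : ℕ) - 2 * t := by
        refine le_of_mul_le_mul_left ?_ hg0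
        nlinarith
      have hm : (0 : ℝ) < (m + 1 : ℕ) := by positivity
      refine le_of_mul_le_mul_left ?_ hm
      rw [h1]
      calc _ = (g * (m + 1 : ℕ)) * kraw (m + 1) 0 t := by ring
        _ ≤ _ := mul_le_mul_of_nonneg_right h2 h0
    | succ j ih =>
      intro hj
      obtain ⟨ih0, ih1⟩ := ih (by omega)
      have h0 : 0 ≤ (kraw n (j + 1) t : ℝ) := le_trans (mul_nonneg hg0.le ih0) ih1
      refine ⟨h0, ?_⟩
      obtain ⟨m, rfl⟩ : ∃ m, n = j + 2 + m := ⟨n - (j + 2), by omega⟩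
      have h1 : ((m + 1 : ℕ) : ℝ) * kraw (j + 2 + m) (j + 2) t
          = ((j + 2 + m : ℕ) - 2 * t : ℝ) * kraw (j + 2 + m) (j + 1) t
            - ((j + 1 : ℕ) : ℝ) * kraw (j + 2 + m) j t := by exact_mod_cast kraw_rec m j t
      have hjk : ((j + 1 : ℕ) : ℝ) ≤ k := by exact_mod_cast (by omega : j + 1 ≤ k)
      -- The left side plus `j + 1` is `g² n + (j + 1)(1 - g²)`, which is at most `g² n + k (1 - g²)
      -- = 2k ≤ g (n - 2t)`.
      have h2 : g * (g * (m + 1 : ℕ)) ≤ g * ((j + 2 + m : ℕ) - 2 * t) - (j + 1 : ℕ) := by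
        have e : ((m + 1 : ℕ) : ℝ) = (j + 2 + m : ℕ) - (j + 1 : ℕ) := by push_cast; ring
        rw [e]
        nlinarith [mul_nonneg (sub_nonneg.2 hjk) (sub_nonneg.2 hg1)]
      have hm : (0 : ℝ) < g * (m + 1 : ℕ) := by positivity
      refine le_of_mul_le_mul_left ?_ hm
      calc g * (m + 1 : ℕ) * (g * (kraw (j + 2 + m) (j + 1) t : ℝ))
          = (g * (g * (m + 1 : ℕ))) * kraw (j + 2 + m) (j + 1) t := by ring
        _ ≤ (g * ((j + 2 + m : ℕ) - 2 * t) - (j + 1 : ℕ)) * kraw (j + 2 + m) (j + 1) t :=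
          mul_le_mul_of_nonneg_right h2 h0
        _ = g * (((j + 2 + m : ℕ) - 2 * t) * kraw (j + 2 + m) (j + 1) t)
            - (j + 1 : ℕ) * kraw (j + 2 + m) (j + 1) t := by ring
        _ ≤ g * (((j + 2 + m : ℕ) - 2 * t) * kraw (j + 2 + m) (j + 1) t)
            - (j + 1 : ℕ) * (g * kraw (j + 2 + m) j t) := by gcongr
        _ = g * (m + 1 : ℕ) * kraw (j + 2 + m) (j + 2) t := by linear_combination -g * h1
  obtain ⟨j, rfl⟩ : ∃ j, k = j + 1 := ⟨k - 1, by omega⟩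
  obtain ⟨h0, h1⟩ := key j le_rfl
  exact_mod_cast le_trans (mul_nonneg hg0.le h0) h1

/-! ### Entropy estimates for binomial coefficients -/

theorem factorial_mul_pow_le_factorial_mul_pow (k j : ℕ) :
    k.factorial * k ^ j ≤ j.factorial * k ^ k := by
  rcases le_total k j with h | h
  · calc k.factorial * k ^ j = k.factorial * k ^ (j - k) * k ^ k := by
          rw [mul_assoc, ← pow_add, Nat.sub_add_cancel h]
      _ ≤ j.factorial * k ^ k := Nat.mul_le_mul_right _ (Nat.factorial_mul_pow_sub_le_factorial h)
  · have h1 : k.factorial ≤ j.factorial * k ^ (k - j) := by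
      rw [← Nat.factorial_mul_descFactorial (Nat.sub_le k j), Nat.sub_sub_self h]
      exact Nat.mul_le_mul_left _ (Nat.descFactorial_le_pow _ _)
    calc k.factorial * k ^ j ≤ j.factorial * k ^ (k - j) * k ^ j := Nat.mul_le_mul_right _ h1
      _ = j.factorial * k ^ k := by rw [mul_assoc, ← pow_add, Nat.sub_add_cancel h]

/-- The binomial distribution with success probability `k/n` has its mode at `k`, so that term is at
least the average of the `n + 1` terms. -/
theorem pow_le_succ_mul_choose {n k : ℕ} (hk : k ≤ n) :
    n ^ n ≤ (n + 1) * (n.choose k * (k ^ k * (n - k) ^ (n - k))) := by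
  have hmode : ∀ j ∈ Finset.range (n + 1), k ^ j * (n - k) ^ (n - j) * n.choose j
      ≤ n.choose k * (k ^ k * (n - k) ^ (n - k)) := by
    intro j hj
    have hj : j ≤ n := by simpa [Nat.lt_succ_iff] using hj
    have h1 := factorial_mul_pow_le_factorial_mul_pow k j
    have h2 := factorial_mul_pow_le_factorial_mul_pow (n - k) (n - j)
    have h3 := Nat.mul_le_mul h1 h2
    have c1 := Nat.choose_mul_factorial_mul_factorial hk
    have c2 := Nat.choose_mul_factorial_mul_factorial hj
    have hp : 0 < k.factorial * (n - k).factorial * (j.factorial * (n - j).factorial) := by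
      positivity
    refine Nat.le_of_mul_le_mul_left ?_ hp
    calc _ = (n.choose j * j.factorial * (n - j).factorial) *
          (k.factorial * k ^ j * ((n - k).factorial * (n - k) ^ (n - j))) := by ring
      _ ≤ (n.choose j * j.factorial * (n - j).factorial) *
          (j.factorial * k ^ k * ((n - j).factorial * (n - k) ^ (n - k))) :=
        Nat.mul_le_mul_left _ h3
      _ = (n.choose k * k.factorial * (n - k).factorial) *
          (j.factorial * k ^ k * ((n - j).factorial * (n - k) ^ (n - k))) := by rw [c1, c2]
      _ = _ := by ring
  calc n ^ n = (k + (n - k)) ^ n := by rw [Nat.add_sub_cancel' hk]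
    _ = ∑ j ∈ Finset.range (n + 1), k ^ j * (n - k) ^ (n - j) * n.choose j := by
      rw [add_pow]; rfl
    _ ≤ _ := by
      refine (Finset.sum_le_card_nsmul _ _ _ hmode).trans ?_
      simp

open Real in
theorem mul_binEntropy_le_log_choose {n k : ℕ} (hk0 : 0 < k) (hk : k < n) :
    n * binEntropy (k / n) ≤ log (n.choose k) + log (n + 1) := by
  have hn : (0 : ℝ) < n := by exact_mod_cast hk0.trans hk
  have hkR : (0 : ℝ) < k := by exact_mod_cast hk0
  have hnk : (0 : ℝ) < n - k := by rw [sub_pos]; exact_mod_cast hk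
  have hc : (0 : ℝ) < n.choose k := by exact_mod_cast Nat.choose_pos hk.le
  have h : (n : ℝ) ^ n ≤ (n + 1) * (n.choose k * (k ^ k * (n - k) ^ (n - k))) := by
    have h2 : ((n ^ n : ℕ) : ℝ) ≤ ((n + 1) * (n.choose k * (k ^ k * (n - k) ^ (n - k))) : ℕ) := by
      exact_mod_cast pow_le_succ_mul_choose hk.le
    push_cast [Nat.cast_sub hk.le] at h2
    exact h2
  have h3 := log_le_log (by positivity) h
  rw [log_mul (by positivity) (by positivity), log_mul (by positivity) (by positivity),
    log_mul (by positivity) (by positivity), log_pow, log_pow, log_pow, Nat.cast_sub hk.le] at h3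
  have e : n * binEntropy (k / n) = n * log n - k * log k - (n - k) * log (n - k) := by
    rw [binEntropy, show (1 : ℝ) - k / n = (n - k) / n by field_simp, log_inv, log_inv,
      log_div hkR.ne' hn.ne', log_div hnk.ne' hn.ne']
    field_simp
    ring
  rw [e]
  linarith

open Real in
theorem log_one_add_sub_log_one_sub_le {u : ℝ} (h0 : 0 ≤ u) (h1 : u ≤ 0.752) :
    log (1 + u) - log (1 - u) ≤ 2.72 * u := by
  rw [← log_div (by linarith) (by linarith), log_le_iff_le_exp (by apply div_pos <;> linarith),
    div_le_iff₀ (by linarith)]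
  have h := sum_le_exp_of_nonneg (x := 2.72 * u) (by positivity) 5
  simp only [Finset.sum_range_succ, Finset.sum_range_zero, Nat.factorial] at h
  refine le_trans ?_ (mul_le_mul_of_nonneg_right h (by linarith))
  have h2 : u ^ 2 ≤ 0.752 * u := by nlinarith
  have h3 : u ^ 3 ≤ 0.752 ^ 2 * u := by nlinarith
  have h4 : u ^ 4 ≤ 0.752 ^ 3 * u := by nlinarith
  have h5 : 0 ≤ 0.72 + 0.979 * u - 0.346 * u ^ 2 - 1.08 * u ^ 3 - 2.29 * u ^ 4 := by nlinarith
  have h6 := mul_nonneg h0 h5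
  push_cast
  norm_num
  nlinarith [pow_nonneg h0 2, pow_nonneg h0 3, pow_nonneg h0 4, pow_nonneg h0 5]

open Real in
theorem mul_log_add_mul_log_le {u : ℝ} (h0 : 0 ≤ u) (h1 : u ≤ 0.752) :
    (1 + u) * log (1 + u) + (1 - u) * log (1 - u) ≤ 1.36 * u ^ 2 := by
  let G : ℝ → ℝ := fun u => 1.36 * u ^ 2 - ((1 + u) * log (1 + u) + (1 - u) * log (1 - u))
  have hd : ∀ x ∈ Set.Icc (0 : ℝ) 0.752,
      HasDerivAt G (2.72 * x - (log (1 + x) - log (1 - x))) x := by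
    intro x hx
    have hp : 1 + x ≠ 0 := by linarith [hx.1]
    have hm : 1 - x ≠ 0 := by linarith [hx.2]
    have d1 : HasDerivAt (fun u : ℝ => 1 + u) 1 x := (hasDerivAt_id x).const_add 1
    have d2 : HasDerivAt (fun u : ℝ => 1 - u) (-1) x := (hasDerivAt_id x).const_sub 1
    have d := (((hasDerivAt_id x).pow 2).const_mul 1.36).sub
      ((d1.mul (d1.log hp)).add (d2.mul (d2.log hm)))
    refine d.congr_deriv ?_
    simp
    field_simp
    ring
  have hmono : MonotoneOn G (Set.Icc 0 0.752) := by
    refine monotoneOn_of_deriv_nonneg (convex_Icc _ _)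
      (fun x hx => (hd x hx).continuousAt.continuousWithinAt)
      (fun x hx => (hd x (interior_subset hx)).differentiableAt.differentiableWithinAt) ?_
    intro x hx
    have hx := interior_subset hx
    rw [(hd x hx).deriv, sub_nonneg]
    exact log_one_add_sub_log_one_sub_le hx.1 hx.2
  have h := hmono ⟨le_rfl, by norm_num⟩ ⟨h0, h1⟩ h0
  simp only [G] at h
  norm_num at h ⊢
  linarith

-- With `u = 1 - 2q`, `binEntropy q` is `log 2` minus half the left side of
-- `mul_log_add_mul_log_le`, whence `0.68 = 1.36 / 2`.
open Real in
theorem log_two_sub_le_binEntropy {q : ℝ} (hq : q ≤ 1 / 2) (h : (1 - 2 * q) ^ 2 ≤ 0.5645) :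
    log 2 - 0.68 * (1 - 2 * q) ^ 2 ≤ binEntropy q := by
  have hu : 1 - 2 * q ≤ 0.752 := by nlinarith
  have h1 := mul_log_add_mul_log_le (u := 1 - 2 * q) (by linarith) hu
  rw [show 1 + (1 - 2 * q) = 2 * (1 - q) by ring, show 1 - (1 - 2 * q) = 2 * q by ring,
    log_mul two_ne_zero (by linarith), log_mul two_ne_zero (by linarith)] at h1
  rw [binEntropy, log_inv, log_inv]
  linarith

open Real in
theorem negMulLog_add_le_binEntropy {p : ℝ} (hp : p < 1) :
    negMulLog p + p * (1 - p) ≤ binEntropy p := by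
  have h := log_le_sub_one_of_pos (show 0 < 1 - p by linarith)
  rw [binEntropy, log_inv, log_inv, negMulLog]
  nlinarith

open Real in
theorem lt_neg_log_seventeen_hundredths : 1.72 < -log 0.17 := by
  rw [← log_inv, lt_log_iff_exp_lt (by norm_num)]
  -- The 25th power makes the exponent an integer: `25 · 1.72 = 43`.
  have h : exp 1.72 ^ 25 < (0.17⁻¹ : ℝ) ^ 25 := by
    rw [← exp_nat_mul, show ((25 : ℕ) : ℝ) * 1.72 = (43 : ℕ) * 1 by norm_num, exp_nat_mul]
    calc exp 1 ^ 43 ≤ 2.7182818286 ^ 43 :=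
          pow_le_pow_left₀ (exp_pos _).le exp_one_lt_d9.le _
      _ < _ := by norm_num
  exact lt_of_pow_lt_pow_left₀ 25 (by norm_num) h

-- The right side is concave in `t / n`, so only the endpoints `6/n` and `0.17` matter. The first
-- gives `6 log n - O(1)`, which is why `t ≥ 6` is required; the second is linear in `n` because
-- `1.72 < -log 0.17`.
open Real Filter in
theorem exists_four_mul_log_le : ∃ N : ℕ, ∀ n t : ℕ, N ≤ n → 6 ≤ t → (t : ℝ) ≤ 0.17 * n →
    4 * log (n + 1) ≤ n * (negMulLog (t / n) - 1.72 * (t / n)) := by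
  set c : ℝ := 0.17 * (-log 0.17 - 1.72) with hc
  have hc0 : 0 < c := by
    have := lt_neg_log_seventeen_hundredths
    rw [hc]; nlinarith
  have e1 : ∀ᶠ x : ℝ in atTop, 4 * log 2 + 6 * log 6 + 10.32 ≤ 2 * log x :=
    (tendsto_log_atTop.const_mul_atTop two_pos).eventually_ge_atTop _
  have e2 : ∀ᶠ x : ℝ in atTop, log x ≤ c / 8 * x := by
    have := isLittleO_log_id_atTop.bound (show 0 < c / 8 by positivity)
    filter_upwards [this, eventually_ge_atTop 1] with x hx h1
    simpa [abs_of_nonneg (log_nonneg h1), abs_of_nonneg (zero_le_one.trans h1)] using hx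
  have e3 : ∀ᶠ x : ℝ in atTop, 8 * log 2 ≤ c * x :=
    (tendsto_id.const_mul_atTop hc0).eventually_ge_atTop _
  obtain ⟨N, hN⟩ := eventually_atTop.1 (tendsto_natCast_atTop_atTop.eventually
    (e1.and (e2.and (e3.and (eventually_ge_atTop (1 : ℝ))))))
  refine ⟨N, fun n t hn ht6 ht => ?_⟩
  obtain ⟨f1, f2, f3, f4⟩ := hN n hn
  have hn0 : (0 : ℝ) < n := by linarith
  have hlog : log (n + 1) ≤ log 2 + log n := by
    rw [← log_mul two_ne_zero hn0.ne']
    exact log_le_log (by positivity) (by linarith)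
  have hconc : ConcaveOn ℝ (Set.Ici (0 : ℝ)) fun x => negMulLog x - 1.72 * x := by
    refine concaveOn_negMulLog.sub ?_
    exact (LinearMap.mul ℝ ℝ 1.72).convexOn (convex_Ici 0)
  have ht6R : (6 : ℝ) ≤ t := by exact_mod_cast ht6
  have hmin := hconc.min_le_of_mem_Icc (x := (6 / n : ℝ)) (y := (0.17 : ℝ)) (z := (t / n : ℝ))
    (Set.mem_Ici.2 (by positivity)) (Set.mem_Ici.2 (by norm_num))
    ⟨by gcongr, by rwa [div_le_iff₀ hn0]⟩
  refine le_trans ?_ (mul_le_mul_of_nonneg_left hmin hn0.le)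
  rw [mul_min_of_nonneg _ _ hn0.le, le_min_iff]
  constructor
  · have : n * (negMulLog (6 / n) - 1.72 * (6 / n)) = 6 * log n - 6 * log 6 - 10.32 := by
      rw [negMulLog, log_div (by norm_num) hn0.ne']
      field_simp
      ring
    rw [this]; linarith
  · have : n * (negMulLog 0.17 - 1.72 * 0.17) = c * n := by
      rw [negMulLog, hc]; ring
    rw [this]; linarith

/-! ### Lower bound for Krawtchouk numbers of small even degree -/

theorem two_mul_kraw_two (k m : ℕ) :
    2 * kraw (k + m) k 2 = ((m : ℤ) - k) ^ 2 - (k + m) := by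
  have h2 := kraw_rec_degree k m 0
  rw [kraw_degree_one, kraw_degree_zero] at h2
  norm_num at h2
  linear_combination h2

theorem twentyfour_mul_kraw_four (k m : ℕ) : 24 * kraw (k + m) k 4
    = ((m : ℤ) - k) ^ 4 - (6 * (k + m) - 8) * ((m : ℤ) - k) ^ 2 + 3 * (k + m) ^ 2
      - 6 * (k + m) := by
  have h2 := two_mul_kraw_two k m
  have h3 := kraw_rec_degree k m 1
  have h4 := kraw_rec_degree k m 2
  rw [kraw_degree_one] at h3
  norm_num at h3 h4
  linear_combination 6 * h4 + 2 * ((m : ℤ) - k) * h3 + (((m : ℤ) - k) ^ 2 - 3 * (k + m - 2)) * h2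

theorem neg_choose_le_kraw_two {n k : ℕ} (hk : k ≤ n) :
    -(n.choose 2 : ℤ) ≤ (n - 1) * kraw n k 2 := by
  rcases Nat.eq_zero_or_pos n with rfl | hn
  · obtain rfl : k = 0 := by omega
    simp [kraw_zero]
  obtain ⟨m, rfl⟩ := Nat.exists_eq_add_of_le hk
  have h1 := two_mul_kraw_two k m
  have h2 := two_mul_kraw_two 0 (k + m)
  rw [zero_add, kraw_zero] at h2
  have hn : (1 : ℤ) ≤ (k + m : ℕ) := by exact_mod_cast hn
  push_cast at h2 hn ⊢
  nlinarith [mul_nonneg (sub_nonneg.2 hn) (sq_nonneg ((m : ℤ) - k))]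

theorem neg_choose_le_kraw_four {n k : ℕ} (hn : 20 ≤ n) (hk : k ≤ n) :
    -(n.choose 4 : ℤ) ≤ (n - 1) * kraw n k 4 := by
  obtain ⟨m, rfl⟩ := Nat.exists_eq_add_of_le hk
  have h1 := twentyfour_mul_kraw_four k m
  have h2 := twentyfour_mul_kraw_four 0 (k + m)
  rw [zero_add, kraw_zero] at h2
  have hn : (20 : ℤ) ≤ (k + m : ℕ) := by exact_mod_cast hn
  push_cast at h2 hn ⊢
  set x : ℤ := k + m with hx
  -- Complete the square in `(m - k)²`; the minimum is at `3x - 4`.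
  have h3 : -(6 * x ^ 2 - 18 * x + 16) ≤ 24 * kraw (k + m) k 4 := by
    rw [h1]
    nlinarith [sq_nonneg (((m : ℤ) - k) ^ 2 - (3 * x - 4))]
  have h4 := mul_le_mul_of_nonneg_left h3 (by linarith : (0 : ℤ) ≤ x - 1)
  have h5 : (x - 1) * (6 * x ^ 2 - 18 * x + 16) ≤ (x - 1) * (x * (x - 2) * (x - 3)) := by
    refine mul_le_mul_of_nonneg_left ?_ (by linarith)
    nlinarith [mul_nonneg (sub_nonneg.2 hn) (sq_nonneg x)]
  nlinarith

open Real in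
theorem exists_neg_choose_le_kraw : ∃ N : ℕ, ∀ n t k : ℕ, N ≤ n → 2 ≤ t → Even t →
    (t : ℝ) ≤ 0.17 * n → k ≤ n → -(n.choose t : ℤ) ≤ (n - 1) * kraw n k t := by
  obtain ⟨N, hN⟩ := exists_four_mul_log_le
  refine ⟨max N 20, fun n t k hn ht2 hte ht hk => ?_⟩
  have hn20 : 20 ≤ n := (le_max_right _ _).trans hn
  wlog hk2 : 2 * k ≤ n generalizing k
  · have := this (n - k) (Nat.sub_le _ _) (by omega)
    rwa [kraw_symm hk, hte.neg_one_pow, one_mul] at this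
  have hn0 : (0 : ℝ) < n := by positivity
  by_cases h2 : t = 2
  · subst h2; exact neg_choose_le_kraw_two hk
  by_cases h4 : t = 4
  · subst h4; exact neg_choose_le_kraw_four hn20 hk
  have ht6 : 6 ≤ t := by
    obtain ⟨a, rfl⟩ := hte
    omega
  have htn' : 2 * (t : ℝ) < n := by linarith
  have htn : 2 * t < n := by exact_mod_cast htn'
  by_cases hreg : 4 * (k : ℝ) * (n - k) ≤ (n - 2 * t) ^ 2
  · have h0 := kraw_nonneg hk2 htn.le hreg
    have : (0 : ℤ) ≤ (n - 1) * kraw n k t := mul_nonneg (by omega) h0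
    have h1 : (0 : ℤ) ≤ n.choose t := by positivity
    linarith
  push Not at hreg
  have hk0 : 0 < k := by
    rcases Nat.eq_zero_or_pos k with rfl | h
    · simp at hreg; nlinarith [sq_nonneg ((n : ℝ) - 2 * t)]
    · exact h
  have hmain := hN n t ((le_max_left _ _).trans hn) ht6 ht
  have c1 := mul_binEntropy_le_log_choose hk0 (by omega : k < n)
  have c2 := mul_binEntropy_le_log_choose (by omega : 0 < t) (by omega : t < n)
  set q : ℝ := k / n with hq
  set τ : ℝ := t / n with hτ
  have hkq : (k : ℝ) = q * n := by rw [hq]; field_simp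
  have htτ : (t : ℝ) = τ * n := by rw [hτ]; field_simp
  have hτ1 : τ ≤ 0.17 := by rwa [hτ, div_le_iff₀ hn0]
  have hτ0 : 0 < τ := by rw [hτ]; positivity
  have hq2 : q ≤ 1 / 2 := by
    rw [hq, div_le_div_iff₀ hn0 two_pos]
    have : 2 * (k : ℝ) ≤ n := by exact_mod_cast hk2
    linarith
  -- The failed inequality reads `4q(1 - q) > (1 - 2τ)²`; subtract both sides from 1.
  have hu : (1 - 2 * q) ^ 2 ≤ 4 * τ * (1 - τ) := by
    rw [hkq, htτ] at hreg
    have hn2 : (0 : ℝ) < n ^ 2 := by positivity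
    refine le_of_mul_le_mul_right ?_ hn2
    nlinarith
  -- `4 · 0.17 · 0.83 = 0.5644`, within the range allowed by the entropy bound.
  have hq3 := log_two_sub_le_binEntropy hq2 (hu.trans (by nlinarith))
  have hτ3 := negMulLog_add_le_binEntropy (show τ < 1 by linarith)
  -- The loss `0.68 · 4τ(1 - τ) = 2.72 τ(1 - τ)` against the gain `τ(1 - τ)` leaves `-1.72 τ(1 - τ)
  -- ≥ -1.72 τ`.
  have hsum : log 2 + (negMulLog τ - 1.72 * τ) ≤ binEntropy q + binEntropy τ := by
    nlinarith
  have hsum' := mul_le_mul_of_nonneg_left hsum hn0.le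
  have hck : (0 : ℝ) < n.choose k := by exact_mod_cast Nat.choose_pos hk
  have hct : (0 : ℝ) < n.choose t := by exact_mod_cast Nat.choose_pos (by omega)
  -- Of the `4 log (n + 1)` available, half pays for the two entropy bounds and half for the factor
  -- `(n + 1)²`, which absorbs `(n - 1)²` below.
  have hlog : log (2 ^ n * (n + 1) ^ 2) ≤ log (n.choose k * n.choose t) := by
    rw [log_mul (by positivity) (by positivity), log_mul hck.ne' hct.ne', log_pow, log_pow]
    push_cast
    linarith
  have hR := (log_le_log_iff (by positivity) (by positivity)).1 hlog
  have hZ : (2 : ℤ) ^ n * (n + 1) ^ 2 ≤ n.choose k * n.choose t := by exact_mod_cast hR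
  have hort := choose_mul_kraw_sq_le hk t
  have hckZ : (0 : ℤ) < n.choose k := by exact_mod_cast hck
  have hctZ : (0 : ℤ) < n.choose t := by exact_mod_cast hct
  have hsq : ((n - 1) * kraw n k t : ℤ) ^ 2 ≤ (n.choose t : ℤ) ^ 2 := by
    refine le_of_mul_le_mul_left ?_ hckZ
    calc (n.choose k : ℤ) * (((n : ℤ) - 1) * kraw n k t) ^ 2
        = ((n : ℤ) - 1) ^ 2 * ((n.choose k : ℤ) * kraw n k t ^ 2) := by ring
      _ ≤ ((n : ℤ) - 1) ^ 2 * ((2 : ℤ) ^ n * (n.choose t : ℤ)) := by gcongr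
      _ ≤ ((n : ℤ) + 1) ^ 2 * ((2 : ℤ) ^ n * (n.choose t : ℤ)) := by
        refine mul_le_mul_of_nonneg_right ?_ (by positivity)
        nlinarith
      _ = ((2 : ℤ) ^ n * ((n : ℤ) + 1) ^ 2) * (n.choose t : ℤ) := by ring
      _ ≤ ((n.choose k : ℤ) * (n.choose t : ℤ)) * (n.choose t : ℤ) := by gcongr
      _ = _ := by ring
  exact (abs_le_of_sq_le_sq' hsq hctZ.le).1

/-! ### Character sums over the connection set -/

open Finset in
theorem sum_filter_card_inter_sdiff {ι M : Type*} [Fintype ι] [DecidableEq ι] [AddCommMonoid M]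
    (T : Finset ι) (a b : ℕ) (f : Finset ι → M) :
    ∑ W ∈ univ.filter (fun W : Finset ι => #(W ∩ T) = a ∧ #(W \ T) = b), f W
      = ∑ U ∈ T.powersetCard a, ∑ V ∈ Tᶜ.powersetCard b, f (U ∪ V) := by
  rw [← sum_product']
  refine sum_nbij' (fun W => (W ∩ T, W \ T)) (fun p => p.1 ∪ p.2) ?_ ?_ ?_ ?_ ?_
  · intro W hW
    simp only [mem_filter, mem_univ, true_and] at hW
    simp only [mem_product, mem_powersetCard]
    refine ⟨⟨inter_subset_right, hW.1⟩, ?_, hW.2⟩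
    intro x hx
    simpa using (mem_sdiff.1 hx).2
  · rintro ⟨U, V⟩ h
    simp only [mem_product, mem_powersetCard] at h
    obtain ⟨⟨hU, hUa⟩, hV, hVb⟩ := h
    simp only [mem_filter, mem_univ, true_and]
    have h1 : (U ∪ V) ∩ T = U := by
      ext x; have := @hU x; have := @hV x; simp at *; tauto
    have h2 : (U ∪ V) \ T = V := by
      ext x; have := @hU x; have := @hV x; simp at *; tauto
    rw [h1, h2]; exact ⟨hUa, hVb⟩
  · intro W _
    ext x; simp; tauto
  · rintro ⟨U, V⟩ h
    simp only [mem_product, mem_powersetCard] at h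
    obtain ⟨⟨hU, hUa⟩, hV, hVb⟩ := h
    ext x <;> · have := @hU x; have := @hV x; simp at *; tauto
  · intro W _
    congr 1
    ext x; simp; tauto

section CharacterSums

open Finset

/-- Vectors over `ℤ₄` as pairs of sets of coordinates: `(T, W)` stands for `1_T + 2 · 1_W`. -/
def pairEquivVec (n : ℕ) : Finset (Fin n) × Finset (Fin n) ≃ (Fin n → ZMod 4) where
  toFun p j := (if j ∈ p.1 then 1 else 0) + (if j ∈ p.2 then 2 else 0)
  invFun v := (univ.filter fun j => v j = 1 ∨ v j = 3, univ.filter fun j => v j = 2 ∨ v j = 3)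
  left_inv := by
    rintro ⟨T, W⟩
    ext j <;> by_cases h1 : j ∈ T <;> by_cases h2 : j ∈ W <;> simp [h1, h2] <;> decide
  right_inv := by
    intro v
    ext j
    simp only [mem_filter, mem_univ, true_and]
    generalize v j = x
    revert x
    decide

theorem pairEquivVec_mem_vectorsOfType {n r s : ℕ} (hn : n = 2 * (r + s)) (T W : Finset (Fin n)) :
    pairEquivVec n (T, W) ∈ vectorsOfType n r s r s ↔
      #T = 2 * s ∧ #(W ∩ T) = s ∧ #(W \ T) = r := by
  have h0 : (univ.filter fun i => pairEquivVec n (T, W) i = 0) = (T ∪ W)ᶜ := by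
    ext j; by_cases h1 : j ∈ T <;> by_cases h2 : j ∈ W <;> rw [mem_filter] <;>
      simp [pairEquivVec, h1, h2] <;> decide
  have h1 : (univ.filter fun i => pairEquivVec n (T, W) i = 1) = T \ W := by
    ext j; by_cases h1 : j ∈ T <;> by_cases h2 : j ∈ W <;> rw [mem_filter] <;>
      simp [pairEquivVec, h1, h2] <;> decide
  have h2 : (univ.filter fun i => pairEquivVec n (T, W) i = 2) = W \ T := by
    ext j; by_cases h1 : j ∈ T <;> by_cases h2 : j ∈ W <;> rw [mem_filter] <;>
      simp [pairEquivVec, h1, h2] <;> decide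
  have h3 : (univ.filter fun i => pairEquivVec n (T, W) i = 3) = W ∩ T := by
    ext j; by_cases h1 : j ∈ T <;> by_cases h2 : j ∈ W <;> rw [mem_filter] <;>
      simp [pairEquivVec, h1, h2] <;> decide
  simp only [vectorsOfType, Set.mem_ofPred_eq, hammingWt, h0, h1, h2, h3]
  have c1 := card_inter_add_card_sdiff T W
  have c2 := card_sdiff_add_card W T
  have c3 := card_compl_add_card (T ∪ W)
  rw [Fintype.card_fin] at c3
  rw [inter_comm] at c1
  rw [union_comm] at c2
  omega

open Classical in
/-- The connection set of the Cayley graph, as a finset. -/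
noncomputable def connectionSet (n r s : ℕ) : Finset (Fin n → ZMod 4) :=
  univ.filter fun v => v ∈ vectorsOfType n r s r s

theorem sum_connectionSet {M : Type*} [AddCommMonoid M] {n r s : ℕ} (hn : n = 2 * (r + s))
    (f : (Fin n → ZMod 4) → M) :
    ∑ v ∈ connectionSet n r s, f v = ∑ T ∈ powersetCard (2 * s) univ,
      ∑ W ∈ univ.filter (fun W : Finset (Fin n) => #(W ∩ T) = s ∧ #(W \ T) = r),
        f (pairEquivVec n (T, W)) := by
  classical
  rw [connectionSet, sum_filter, ← (pairEquivVec n).sum_comp, Fintype.sum_prod_type,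
    ← univ_filter_card_eq, sum_filter]
  refine sum_congr rfl fun T _ => ?_
  simp only [pairEquivVec_mem_vectorsOfType hn]
  by_cases hT : #T = 2 * s
  · simp [hT, sum_filter]
  · simp [hT]

/-- The sum of `∏ j ∈ W, ε j` over the sets `W` that have `s` elements in `T` and `r` outside. -/
def balancedSum {n : ℕ} (r s : ℕ) (ε : Fin n → ℤ) (T : Finset (Fin n)) : ℤ :=
  ∑ W ∈ univ.filter (fun W : Finset (Fin n) => #(W ∩ T) = s ∧ #(W \ T) = r), ∏ j ∈ W, ε j

theorem balancedSum_eq {n r s : ℕ} (ε : Fin n → ℤ) (hε : ∀ j, ε j = 1 ∨ ε j = -1)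
    (T : Finset (Fin n)) : balancedSum r s ε T
      = kraw #T #{j ∈ T | ε j = -1} s * kraw #Tᶜ #{j ∈ Tᶜ | ε j = -1} r := by
  rw [balancedSum, sum_filter_card_inter_sdiff, ← sum_powersetCard_prod T ε (fun j _ => hε j),
    ← sum_powersetCard_prod Tᶜ ε (fun j _ => hε j), sum_mul_sum]
  refine sum_congr rfl fun U hU => sum_congr rfl fun V hV => ?_
  refine prod_union ?_
  exact disjoint_of_subset_left (mem_powersetCard.1 hU).1
    (disjoint_of_subset_right (mem_powersetCard.1 hV).1 disjoint_compl_right)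

/-- Exchange the sums: `W` runs over the `(r + s)`-sets, and each admits `C(r+s, s)²` sets `T`, with
`s` elements inside `W` and `s` outside. -/
theorem sum_balancedSum {n r s : ℕ} (hn : n = 2 * (r + s)) (ε : Fin n → ℤ)
    (hε : ∀ j, ε j = 1 ∨ ε j = -1) :
    ∑ T ∈ powersetCard (2 * s) univ, balancedSum r s ε T
      = ((r + s).choose s : ℤ) ^ 2 * kraw n #{j | ε j = -1} (r + s) := by
  have hswap : ∑ T ∈ powersetCard (2 * s) univ, balancedSum r s ε T
      = ∑ W ∈ powersetCard (r + s) univ,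
        ∑ T ∈ univ.filter (fun T : Finset (Fin n) => #(T ∩ W) = s ∧ #(T \ W) = s),
          ∏ j ∈ W, ε j := by
    refine sum_comm' fun T W => ?_
    simp only [mem_powersetCard_univ, mem_filter, mem_univ, true_and]
    have c1 := card_inter_add_card_sdiff T W
    have c2 := card_inter_add_card_sdiff W T
    rw [inter_comm] at c1
    rw [inter_comm T W]
    omega
  have hin := sum_powersetCard_prod univ ε (fun j _ => hε j) (r + s)
  rw [card_univ, Fintype.card_fin] at hin
  rw [hswap, ← hin, mul_sum]
  refine sum_congr rfl fun W hW => ?_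
  have hWc := mem_powersetCard_univ.1 hW
  have hWc' : #Wᶜ = r + s := by rw [card_compl, Fintype.card_fin]; omega
  rw [sum_filter_card_inter_sdiff]
  simp [hWc, hWc', pow_two, mul_assoc]

/-- Both Krawtchouk factors have middle degree. They vanish at odd arguments, and at `2a` and `2b`
their signs multiply to `(-1)^(a+b)`, which depends only on the total count. -/
theorem balancedSum_sign {n r s : ℕ} (hn : n = 2 * (r + s)) (ε : Fin n → ℤ)
    (hε : ∀ j, ε j = 1 ∨ ε j = -1) {T : Finset (Fin n)} (hT : #T = 2 * s) :
    0 ≤ (-1) ^ (#{j | ε j = -1} / 2) * balancedSum r s ε T := by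
  have hTc : #Tᶜ = 2 * r := by rw [card_compl, Fintype.card_fin]; omega
  have hk : #{j ∈ T | ε j = -1} + #{j ∈ Tᶜ | ε j = -1} = #{j | ε j = -1} := by
    rw [← card_union_of_disjoint, ← filter_union, union_compl]
    exact disjoint_filter_filter disjoint_compl_right
  have b1 := card_filter_le T fun j => ε j = -1
  have b2 := card_filter_le Tᶜ fun j => ε j = -1
  rw [balancedSum_eq ε hε, hT, hTc, ← hk]
  rw [hT] at b1
  rw [hTc] at b2
  generalize #{j ∈ T | ε j = -1} = i at *
  generalize #{j ∈ Tᶜ | ε j = -1} = l at *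
  rcases Nat.even_or_odd' i with ⟨a, rfl | rfl⟩
  · rcases Nat.even_or_odd' l with ⟨b, rfl | rfl⟩
    · rw [show (2 * a + 2 * b) / 2 = a + b by omega, pow_add]
      have := mul_nonneg (kraw_middle_even_nonneg s a b1) (kraw_middle_even_nonneg r b b2)
      linarith
    · simp [kraw_middle_odd r b b2]
  · simp [kraw_middle_odd s a b1]

theorem addChar_map_sum {A M ι : Type*} [AddCommMonoid A] [CommMonoid M] (ψ : AddChar A M)
    (T : Finset ι) (f : ι → A) : ψ (∑ j ∈ T, f j) = ∏ j ∈ T, ψ (f j) := by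
  classical
  induction T using Finset.induction_on with
  | empty => simp
  | insert j T hj ih => rw [sum_insert hj, prod_insert hj, AddChar.map_add_eq_mul, ih]

theorem addChar_pairEquivVec {n : ℕ} (ψ : AddChar (Fin n → ZMod 4) ℂ) (T W : Finset (Fin n)) :
    ψ (pairEquivVec n (T, W))
      = (∏ j ∈ T, ψ (Pi.single j 1)) * ∏ j ∈ W, ψ (Pi.single j 1) ^ 2 := by
  have h : pairEquivVec n (T, W)
      = ∑ j ∈ T, Pi.single j (1 : ZMod 4) + ∑ j ∈ W, 2 • Pi.single j (1 : ZMod 4) := by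
    ext j
    simp [pairEquivVec, Finset.sum_apply, Pi.single_apply]
  rw [h, AddChar.map_add_eq_mul, addChar_map_sum, addChar_map_sum]
  simp only [AddChar.map_nsmul_eq_pow]

theorem addChar_single_pow_four {n : ℕ} (ψ : AddChar (Fin n → ZMod 4) ℂ) (j : Fin n) :
    ψ (Pi.single j 1) ^ 4 = 1 := by
  rw [← AddChar.map_nsmul_eq_pow, ← Pi.single_smul]
  rw [show (4 : ℕ) • (1 : ZMod 4) = 0 by decide, Pi.single_zero, AddChar.map_zero_eq_one]

theorem sum_connectionSet_addChar {n r s : ℕ} (hn : n = 2 * (r + s))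
    (ψ : AddChar (Fin n → ZMod 4) ℂ) (ε : Fin n → ℤ)
    (hψ : ∀ j, ψ (Pi.single j 1) ^ 2 = ε j) :
    ∑ v ∈ connectionSet n r s, ψ v = ∑ T ∈ powersetCard (2 * s) univ,
      (∏ j ∈ T, ψ (Pi.single j 1)) * (balancedSum r s ε T : ℂ) := by
  rw [sum_connectionSet hn]
  refine sum_congr rfl fun T _ => ?_
  rw [balancedSum, Int.cast_sum, mul_sum]
  refine sum_congr rfl fun W _ => ?_
  rw [addChar_pairEquivVec]
  simp [hψ]

theorem card_connectionSet_middle {n r s : ℕ} (hn : n = 2 * (r + s)) :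
    (#(connectionSet n r s) : ℤ) = ((r + s).choose s : ℤ) ^ 2 * n.choose (r + s) := by
  have h := sum_balancedSum hn (fun _ => 1) (fun _ => Or.inl rfl)
  rw [card_eq_sum_ones, Nat.cast_sum, sum_connectionSet hn]
  simpa [balancedSum, kraw_zero] using h

theorem card_connectionSet_even {n r s : ℕ} (hn : n = 2 * (r + s)) :
    (#(connectionSet n r s) : ℤ)
      = n.choose (2 * s) * ((2 * s).choose s * (2 * r).choose r) := by
  have h : ∀ T ∈ powersetCard (2 * s) (univ : Finset (Fin n)),
      balancedSum r s (fun _ => 1) T = (2 * s).choose s * (2 * r).choose r := by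
    intro T hT
    have hT := mem_powersetCard_univ.1 hT
    have hTc : #Tᶜ = 2 * r := by rw [card_compl, Fintype.card_fin]; omega
    rw [balancedSum_eq _ (fun _ => Or.inl rfl), hT, hTc]
    simp [kraw_zero]
  have h2 := sum_congr rfl h
  rw [card_eq_sum_ones, Nat.cast_sum, sum_connectionSet hn]
  rw [sum_const, card_powersetCard, card_univ, Fintype.card_fin, nsmul_eq_mul] at h2
  rw [← h2]
  refine sum_congr rfl fun T _ => ?_
  simp [balancedSum]

/-- The inner sums share one sign, so the sum of their absolute values equals the absolute value of
their sum, evaluated by `sum_balancedSum`. -/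
theorem neg_card_le_re_sum_addChar_of_mixed {n r s : ℕ} (hn : n = 2 * (r + s))
    (ψ : AddChar (Fin n → ZMod 4) ℂ) (ε : Fin n → ℤ) (hε : ∀ j, ε j = 1 ∨ ε j = -1)
    (hψ : ∀ j, ψ (Pi.single j 1) ^ 2 = ε j) (h0 : 0 < #{j | ε j = -1})
    (h1 : #{j | ε j = -1} < n) :
    -(#(connectionSet n r s) : ℝ) ≤ (n - 1) * (∑ v ∈ connectionSet n r s, ψ v).re := by
  set k := #{j | ε j = -1} with hk
  have hnorm : ‖∑ v ∈ connectionSet n r s, ψ v‖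
      ≤ ((r + s).choose s : ℝ) ^ 2 * |(kraw n k (r + s) : ℝ)| := by
    rw [sum_connectionSet_addChar hn ψ ε hψ]
    calc _ ≤ ∑ T ∈ powersetCard (2 * s) (univ : Finset (Fin n)),
          (((-1) ^ (k / 2) * balancedSum r s ε T : ℤ) : ℝ) := by
          refine norm_sum_le_of_le _ fun T hT => ?_
          have hs := balancedSum_sign hn ε hε (mem_powersetCard_univ.1 hT)
          rw [← hk] at hs
          rw [norm_mul, norm_prod, prod_eq_one fun j _ => AddChar.norm_apply ψ _, one_mul,
            Complex.norm_intCast, ← Int.cast_abs, ← abs_of_nonneg hs, abs_mul]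
          simp
      _ = (((-1) ^ (k / 2) * (((r + s).choose s : ℤ) ^ 2 * kraw n k (r + s)) : ℤ) : ℝ) := by
          rw [← Int.cast_sum, ← mul_sum, sum_balancedSum hn ε hε]
      _ ≤ |(((-1) ^ (k / 2) * (((r + s).choose s : ℤ) ^ 2 * kraw n k (r + s)) : ℤ) : ℝ)| :=
          le_abs_self _
      _ = _ := by
          push_cast
          simp [abs_mul]
  have hmid : (n - 1 : ℝ) * |(kraw n k (r + s) : ℝ)| ≤ n.choose (r + s) := by
    have := kraw_middle_abs_le (m := r + s) h0 (hn ▸ h1)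
    rw [← hn] at this
    have h2 : ((n : ℤ) - 1) * |kraw n k (r + s)| ≤ n.choose (r + s) := by
      rw [show (n : ℤ) = 2 * (r + s : ℕ) by rw [hn]; push_cast; ring]
      exact_mod_cast this
    exact_mod_cast h2
  have hcard : (#(connectionSet n r s) : ℝ) = ((r + s).choose s : ℝ) ^ 2 * n.choose (r + s) := by
    exact_mod_cast card_connectionSet_middle hn
  have hn1 : (0 : ℝ) ≤ n - 1 := by
    rw [sub_nonneg]; exact_mod_cast (by omega : 1 ≤ n)
  have hre := neg_le_of_abs_le (Complex.abs_re_le_norm (∑ v ∈ connectionSet n r s, ψ v))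
  rw [hcard]
  have hsq : (0 : ℝ) ≤ ((r + s).choose s : ℝ) ^ 2 := by positivity
  nlinarith [mul_le_mul_of_nonneg_left hnorm hn1, mul_le_mul_of_nonneg_left hre hn1,
    mul_le_mul_of_nonneg_left hmid hsq]

theorem neg_card_le_re_of_eq_kraw {n r s l : ℕ} (hn : n = 2 * (r + s))
    (hkraw : -(n.choose (2 * s) : ℤ) ≤ (n - 1) * kraw n l (2 * s)) {z : ℂ}
    (hz : z = ((kraw n l (2 * s) * ((2 * s).choose s * (2 * r).choose r) : ℤ) : ℂ)) :
    -(#(connectionSet n r s) : ℝ) ≤ (n - 1) * z.re := by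
  rw [hz, Complex.intCast_re]
  have h2 : -(#(connectionSet n r s) : ℤ)
      ≤ (n - 1) * (kraw n l (2 * s) * ((2 * s).choose s * (2 * r).choose r)) := by
    rw [card_connectionSet_even hn]
    have hc : (0 : ℤ) ≤ (2 * s).choose s * (2 * r).choose r := by positivity
    nlinarith [mul_le_mul_of_nonneg_right hkraw hc]
  exact_mod_cast h2

theorem neg_card_le_re_sum_addChar {n r s : ℕ} (hn : n = 2 * (r + s)) (hr : Even r)
    (hkraw : ∀ k ≤ n, -(n.choose (2 * s) : ℤ) ≤ (n - 1) * kraw n k (2 * s))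
    (ψ : AddChar (Fin n → ZMod 4) ℂ) :
    -(#(connectionSet n r s) : ℝ) ≤ (n - 1) * (∑ v ∈ connectionSet n r s, ψ v).re := by
  have hsq : ∀ j, ∃ e : ℤ, (e = 1 ∨ e = -1) ∧ ψ (Pi.single j 1) ^ 2 = e := by
    intro j
    have h : (ψ (Pi.single j 1) ^ 2) ^ 2 = 1 := by
      rw [← pow_mul]; exact addChar_single_pow_four ψ j
    rcases sq_eq_one_iff.1 h with h | h
    · exact ⟨1, Or.inl rfl, by simpa using h⟩
    · exact ⟨-1, Or.inr rfl, by simpa using h⟩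
  choose ε hε hψ using hsq
  have hle : #{j | ε j = -1} ≤ n := by simpa using card_filter_le univ fun j => ε j = -1
  by_cases h0 : 0 < #{j | ε j = -1}
  · by_cases h1 : #{j | ε j = -1} < n
    · exact neg_card_le_re_sum_addChar_of_mixed hn ψ ε hε hψ h0 h1
    have hall : ∀ j, ε j = -1 := by
      have : (univ.filter fun j => ε j = -1) = univ := by
        rw [← card_eq_iff_eq_univ, Fintype.card_fin]; omega
      intro j
      have hj := mem_univ j
      rw [← this] at hj
      exact (mem_filter.1 hj).2
    have hδ : ∀ j, ∃ d : ℤ, (d = 1 ∨ d = -1) ∧ ψ (Pi.single j 1) = Complex.I * d := by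
      intro j
      have h := hψ j
      rw [hall j] at h
      have h' : ψ (Pi.single j 1) ^ 2 = Complex.I ^ 2 := by rw [h]; simp
      rcases sq_eq_sq_iff_eq_or_eq_neg.1 h' with h | h
      · exact ⟨1, Or.inl rfl, by simpa using h⟩
      · exact ⟨-1, Or.inr rfl, by simpa using h⟩
    choose δ hδ hψδ using hδ
    have hsum := sum_powersetCard_prod univ δ (fun j _ => hδ j) (2 * s)
    rw [card_univ, Fintype.card_fin] at hsum
    refine neg_card_le_re_of_eq_kraw hn
      (hkraw #{j | δ j = -1} (by simpa using card_filter_le univ fun j => δ j = -1)) ?_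
    rw [sum_connectionSet_addChar hn ψ ε hψ, ← hsum, sum_mul, Int.cast_sum]
    refine sum_congr rfl fun T hT => ?_
    have hT := mem_powersetCard_univ.1 hT
    have hTc : #Tᶜ = 2 * r := by rw [card_compl, Fintype.card_fin]; omega
    have hs := kraw_symm (n := 2 * s) (k := 0) (by omega) s
    have hr' := kraw_symm (n := 2 * r) (k := 0) (by omega) r
    rw [Nat.sub_zero, kraw_zero] at hs hr'
    rw [balancedSum_eq ε hε, filter_true_of_mem fun j _ => hall j,
      filter_true_of_mem fun j _ => hall j, hT, hTc, hs, hr', hr.neg_one_pow]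
    simp only [hψδ, prod_mul_distrib, prod_const, hT, pow_mul, Complex.I_sq]
    push_cast
    -- One `(-1)^s` comes from `I^(2s)`, the other from the degree-`s` Krawtchouk number at its last
    -- argument.
    have : ((-1 : ℂ) ^ s) * (-1) ^ s = 1 := by rw [← mul_pow]; simp
    linear_combination (∏ j ∈ T, (δ j : ℂ)) * ((2 * s).choose s * (2 * r).choose r) * this
  · have hall : ∀ j, ε j = 1 := by
      intro j
      refine (hε j).resolve_right fun hj => h0 (card_pos.2 ⟨j, by simpa using hj⟩)
    have hδ : ∀ j, ∃ d : ℤ, (d = 1 ∨ d = -1) ∧ ψ (Pi.single j 1) = d := by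
      intro j
      have h := hψ j
      rw [hall j, Int.cast_one] at h
      rcases sq_eq_one_iff.1 h with h | h
      · exact ⟨1, Or.inl rfl, by simpa using h⟩
      · exact ⟨-1, Or.inr rfl, by simpa using h⟩
    choose δ hδ hψδ using hδ
    have hsum := sum_powersetCard_prod univ δ (fun j _ => hδ j) (2 * s)
    rw [card_univ, Fintype.card_fin] at hsum
    refine neg_card_le_re_of_eq_kraw hn
      (hkraw #{j | δ j = -1} (by simpa using card_filter_le univ fun j => δ j = -1)) ?_
    rw [sum_connectionSet_addChar hn ψ ε hψ, ← hsum, sum_mul, Int.cast_sum]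
    refine sum_congr rfl fun T hT => ?_
    have hT := mem_powersetCard_univ.1 hT
    have hTc : #Tᶜ = 2 * r := by rw [card_compl, Fintype.card_fin]; omega
    rw [balancedSum_eq ε hε, hT, hTc]
    simp [hall, hψδ, kraw_zero]

end CharacterSums

/-! ### Hoffman bound for quantum colorings -/

section HoffmanBound

open Finset ComplexConjugate

variable {G : Type*} [AddCommGroup G] [Fintype G]

/-- The Fourier coefficient of `f` at the character `ψ`. -/
noncomputable def charTransform (f : G → ℂ) (ψ : AddChar G ℂ) : ℂ := ∑ v, ψ v * f v

/-- Expand the squared norm into a double sum; orthogonality of characters keeps only `w = u + v`.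
-/
theorem sum_addChar_mul_norm_sq (S : Finset G) (f : G → ℂ) :
    ∑ ψ : AddChar G ℂ, (∑ u ∈ S, ψ u) * (‖charTransform f ψ‖ ^ 2 : ℝ)
      = Fintype.card G * ∑ u ∈ S, ∑ v, f v * conj (f (v + u)) := by
  classical
  have h : ∀ ψ : AddChar G ℂ, (∑ u ∈ S, ψ u) * ((‖charTransform f ψ‖ ^ 2 : ℝ) : ℂ)
      = ∑ u ∈ S, ∑ v, ∑ w, ψ (u + v - w) * (f v * conj (f w)) := by
    intro ψ
    rw [Complex.ofReal_pow, ← Complex.mul_conj', charTransform, map_sum, sum_mul_sum, sum_mul]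
    refine sum_congr rfl fun u _ => ?_
    rw [mul_sum]
    refine sum_congr rfl fun v _ => ?_
    rw [mul_sum]
    refine sum_congr rfl fun w _ => ?_
    rw [sub_eq_add_neg, AddChar.map_add_eq_mul, AddChar.map_add_eq_mul, AddChar.map_neg_eq_conj,
      map_mul]
    ring
  simp_rw [h]
  rw [sum_comm, mul_sum]
  refine sum_congr rfl fun u _ => ?_
  rw [sum_comm, mul_sum]
  refine sum_congr rfl fun v _ => ?_
  rw [sum_comm]
  simp_rw [← sum_mul, AddChar.sum_apply_eq_ite, sub_eq_zero, ite_mul, zero_mul]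
  rw [sum_ite_eq univ (u + v)]
  simp [add_comm]

theorem sum_mul_conj_eq_trace {d : ℕ} {A B : Matrix (Fin d) (Fin d) ℂ} (hB : IsSelfAdjoint B) :
    ∑ a, ∑ b, A a b * conj (B a b) = (A * B).trace := by
  have h : ∀ a b, conj (B a b) = B b a := fun a b => by
    conv_rhs => rw [← hB.star_eq]
    rfl
  simp [Matrix.trace, Matrix.mul_apply, h]

/-- **Hoffman bound** for quantum colorings of a Cayley graph. -/
theorem le_of_quantumColoring {Γ : SimpleGraph G} {S : Finset G} {c d n : ℕ} (hS : 0 < #S)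
    (hadj : ∀ v, ∀ u ∈ S, Γ.Adj v (v + u))
    (hψ : ∀ ψ : AddChar G ℂ, -(#S : ℝ) ≤ (n - 1) * (∑ u ∈ S, ψ u).re)
    (Q : QuantumColoring Γ c d) : n ≤ c := by
  classical
  let F : Fin c → Fin d → Fin d → AddChar G ℂ → ℂ := fun i a b ψ =>
    charTransform (fun v => Q.P v i a b) ψ
  -- Spectral mass of the coloring at `ψ`. Its weighted sum against the eigenvalues is a sum of
  -- traces of `P v i * P (v + u) i`, which vanish on edges.
  let m : AddChar G ℂ → ℝ := fun ψ => ∑ i, ∑ a, ∑ b, ‖F i a b ψ‖ ^ 2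
  have hm : ∀ ψ, 0 ≤ m ψ := fun ψ => by positivity
  have hsum : ∀ S' : Finset G, ∑ ψ, (∑ u ∈ S', ψ u) * (m ψ : ℂ)
      = Fintype.card G * ∑ i, ∑ u ∈ S', ∑ v, (Q.P v i * Q.P (v + u) i).trace := by
    intro S'
    have e : ∀ ψ : AddChar G ℂ, (∑ u ∈ S', ψ u) * (m ψ : ℂ)
        = ∑ i, ∑ a, ∑ b, (∑ u ∈ S', ψ u) * ((‖F i a b ψ‖ ^ 2 : ℝ) : ℂ) := by
      intro ψ
      simp only [m, Complex.ofReal_sum, mul_sum]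
    simp_rw [e]
    rw [sum_comm, mul_sum]
    refine sum_congr rfl fun i _ => ?_
    simp_rw [← sum_mul_conj_eq_trace (Q.isStarProjection _ i).isSelfAdjoint]
    rw [sum_comm]
    have e2 : ∀ a, ∑ ψ : AddChar G ℂ, ∑ b, (∑ u ∈ S', ψ u) * ((‖F i a b ψ‖ ^ 2 : ℝ) : ℂ)
        = ∑ b, Fintype.card G * ∑ u ∈ S', ∑ v, Q.P v i a b * conj (Q.P (v + u) i a b) := by
      intro a
      rw [sum_comm]
      exact sum_congr rfl fun b _ => sum_addChar_mul_norm_sq S' fun v => Q.P v i a b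
    simp_rw [e2, ← mul_sum]
    congr 1
    simp_rw [sum_comm (s := (univ : Finset (Fin d))) (t := S')]
    refine sum_congr rfl fun u _ => ?_
    simp_rw [sum_comm (s := (univ : Finset (Fin d))) (t := (univ : Finset G))]
  have hzero : ∑ ψ, (∑ u ∈ S, ψ u).re * m ψ = 0 := by
    have h := congrArg Complex.re (hsum S)
    rw [Complex.re_sum] at h
    simp only [Complex.re_mul_ofReal] at h
    rw [h, sum_eq_zero]
    · simp
    · intro i _
      refine sum_eq_zero fun u hu => sum_eq_zero fun v _ => ?_
      rw [Q.mul_eq_zero v (v + u) (hadj v u hu) i, Matrix.trace_zero]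
  -- Parseval: the case `S' = {0}`, where the traces of the projections add up to `d` at each
  -- vertex.
  have htotal : ∑ ψ, m ψ = (Fintype.card G : ℝ) ^ 2 * d := by
    have h := hsum {0}
    have e : ∑ i, ∑ v, (Q.P v i).trace = Fintype.card G * (d : ℂ) := by
      rw [sum_comm]
      have htr : ∀ v, ∑ i, (Q.P v i).trace = d := fun v => by
        rw [← Matrix.trace_sum, Q.sum_eq_one, Matrix.trace_one, Fintype.card_fin]
      simp [htr]
    simp only [sum_singleton, AddChar.map_zero_eq_one, one_mul, add_zero] at h
    simp_rw [(Q.isStarProjection _ _).isIdempotentElem.eq] at h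
    rw [e] at h
    have h2 : ((∑ ψ, m ψ : ℝ) : ℂ) = (((Fintype.card G : ℝ) ^ 2 * d : ℝ) : ℂ) := by
      push_cast; rw [h]; ring
    exact_mod_cast h2
  -- Diagonal entries suffice: at the trivial character they sum over colors to `|G|`, and
  -- Cauchy–Schwarz over the `c` colors applies.
  have hcs : (d : ℝ) * (Fintype.card G : ℝ) ^ 2 ≤ c * m 0 := by
    have h1 : ∀ a : Fin d, (Fintype.card G : ℝ) ^ 2 ≤ c * ∑ i, ‖F i a a 0‖ ^ 2 := by
      intro a
      have e : ∑ i, F i a a 0 = Fintype.card G := by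
        simp only [F, charTransform, AddChar.zero_apply, one_mul]
        rw [sum_comm]
        have : ∀ v, ∑ i, Q.P v i a a = 1 := fun v => by
          rw [← Matrix.sum_apply, Q.sum_eq_one, Matrix.one_apply_eq]
        simp [this]
      calc (Fintype.card G : ℝ) ^ 2 = ‖∑ i, F i a a 0‖ ^ 2 := by rw [e]; simp
        _ ≤ (∑ i, ‖F i a a 0‖) ^ 2 := by gcongr; exact norm_sum_le _ _
        _ ≤ c * ∑ i, ‖F i a a 0‖ ^ 2 := by
          simpa using sq_sum_le_card_mul_sum_sq (s := univ) (f := fun i => ‖F i a a 0‖)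
    calc (d : ℝ) * (Fintype.card G : ℝ) ^ 2 = ∑ _a : Fin d, (Fintype.card G : ℝ) ^ 2 := by simp
      _ ≤ ∑ a, c * ∑ i, ‖F i a a 0‖ ^ 2 := sum_le_sum fun a _ => h1 a
      _ = c * ∑ i, ∑ a, ‖F i a a 0‖ ^ 2 := by rw [← mul_sum, sum_comm]
      _ ≤ c * m 0 := by
        refine mul_le_mul_of_nonneg_left ?_ (by positivity)
        refine sum_le_sum fun i _ => sum_le_sum fun a _ => ?_
        exact single_le_sum (f := fun b => ‖F i a b 0‖ ^ 2) (fun b _ => by positivity) (mem_univ a)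
  -- At `ψ = 0` the eigenvalue is `|S|` and equality holds. Summing over `ψ` gives `n · m 0 ≤ ∑ m`,
  -- to be played against `hcs`.
  have hpt : ∀ ψ : AddChar G ℂ, -(#S : ℝ) * m ψ + (if ψ = 0 then n * #S * m 0 else 0)
      ≤ (n - 1) * ((∑ u ∈ S, ψ u).re * m ψ) := by
    intro ψ
    split_ifs with h
    · subst h
      simp
      apply le_of_eq; ring
    · have := mul_le_mul_of_nonneg_right (hψ ψ) (hm ψ)
      linarith
  have hS' : (0 : ℝ) < #S := by exact_mod_cast hS
  have hfin := sum_le_sum fun ψ (_ : ψ ∈ univ) => hpt ψ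
  rw [sum_add_distrib, ← mul_sum, ← mul_sum, hzero, htotal, sum_ite_eq' univ (0 : AddChar G ℂ),
    if_pos (mem_univ _)] at hfin
  have h1 : n * m 0 ≤ (Fintype.card G : ℝ) ^ 2 * d := by
    refine le_of_mul_le_mul_left ?_ hS'
    linarith
  have hG : (0 : ℝ) < Fintype.card G := by exact_mod_cast Fintype.card_pos
  have hd : (0 : ℝ) < d := by exact_mod_cast Q.dim_pos
  have h2 : (n : ℝ) * ((Fintype.card G : ℝ) ^ 2 * d) ≤ c * ((Fintype.card G : ℝ) ^ 2 * d) :=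
    calc (n : ℝ) * ((Fintype.card G : ℝ) ^ 2 * d) = n * (d * (Fintype.card G : ℝ) ^ 2) := by ring
      _ ≤ n * (c * m 0) := by gcongr
      _ = c * (n * m 0) := by ring
      _ ≤ c * ((Fintype.card G : ℝ) ^ 2 * d) := by gcongr
  exact_mod_cast le_of_mul_le_mul_right h2 (by positivity)

end HoffmanBound

/-! ### The quantum coloring with `n` colors -/

section FourierColoring

open Finset ZMod ComplexConjugate

theorem stdAddChar_four_two : stdAddChar (N := 4) 2 = -1 := by
  have h : stdAddChar (N := 4) 2 ^ 2 = 1 := by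
    rw [← AddChar.map_nsmul_eq_pow, show (2 : ℕ) • (2 : ZMod 4) = 0 by decide,
      AddChar.map_zero_eq_one]
  refine (sq_eq_one_iff.1 h).resolve_left fun h1 => ?_
  rw [← AddChar.map_zero_eq_one (stdAddChar (N := 4)), injective_stdAddChar.eq_iff] at h1
  exact absurd h1 (by decide)

theorem sum_stdAddChar_eq_zero {n r s : ℕ} {v : Fin n → ZMod 4}
    (hv : v ∈ vectorsOfType n r s r s) : ∑ a, stdAddChar (v a) = 0 := by
  have h : ∑ a, stdAddChar (v a) = ∑ k : ZMod 4, (hammingWt k v : ℂ) * stdAddChar k := by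
    rw [← sum_fiberwise (univ : Finset (Fin n)) v]
    refine sum_congr rfl fun k _ => ?_
    rw [sum_congr rfl (g := fun _ => stdAddChar k), sum_const, nsmul_eq_mul, hammingWt]
    intro a ha
    rw [(mem_filter.1 ha).2]
  obtain ⟨h0, h1, h2, h3⟩ := hv
  have h4 : (stdAddChar (3 : ZMod 4) : ℂ) = - stdAddChar (1 : ZMod 4) := by
    rw [show (3 : ZMod 4) = 2 + 1 by decide, AddChar.map_add_eq_mul, stdAddChar_four_two]; ring
  have hu : (univ : Finset (ZMod 4)) = {0, 1, 2, 3} := by decide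
  rw [h, hu, sum_insert (by decide), sum_insert (by decide), sum_insert (by decide),
    sum_singleton, h0, h1, h2, h3, h4, stdAddChar_four_two, AddChar.map_zero_eq_one]
  ring

theorem quantumColorable_cayleyZ4 {n : ℕ} (r s : ℕ) (hn : 0 < n) :
    QuantumColorable (cayleyZ4 n r s) n := by
  have : NeZero n := ⟨hn.ne'⟩
  have hn0 : (n : ℂ) ≠ 0 := by exact_mod_cast hn.ne'
  let e : Fin n ≃ ZMod n := (ZMod.finEquiv n).toEquiv
  -- Rank-one projection onto the unit vector with entries `n^(-1/2) i^(v_a) ω^(e(i) e(a))`, where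
  -- `ω` is a primitive `n`-th root of unity.
  let P : (Fin n → ZMod 4) → Fin n → Matrix (Fin n) (Fin n) ℂ := fun v i => Matrix.of fun a b =>
    (n : ℂ)⁻¹ * stdAddChar (v a - v b) * stdAddChar (e i * (e a - e b))
  have hmul : ∀ v w i a c, (P v i * P w i) a c = (n : ℂ)⁻¹ ^ 2 * stdAddChar (v a - w c) *
      stdAddChar (e i * (e a - e c)) * ∑ b, stdAddChar (w b - v b) := by
    intro v w i a c
    rw [Matrix.mul_apply, mul_sum]
    refine sum_congr rfl fun b _ => ?_
    simp only [P, Matrix.of_apply]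
    rw [show e i * (e a - e c) = e i * (e a - e b) + e i * (e b - e c) by ring,
      AddChar.map_add_eq_mul]
    have : stdAddChar (v a - v b) * stdAddChar (w b - w c)
        = stdAddChar (v a - w c) * stdAddChar (w b - v b) := by
      rw [← AddChar.map_add_eq_mul, ← AddChar.map_add_eq_mul]; congr 1; ring
    linear_combination (n : ℂ)⁻¹ ^ 2 * stdAddChar (e i * (e a - e b)) *
      stdAddChar (e i * (e b - e c)) * this
  refine ⟨n, ⟨⟨hn, P, fun v i => ⟨?_, ?_⟩, fun v => ?_, fun v w hvw i => ?_⟩⟩⟩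
  · ext a c
    rw [hmul]
    simp only [sub_self, AddChar.map_zero_eq_one, sum_const, card_univ, Fintype.card_fin,
      nsmul_eq_mul, mul_one, P, Matrix.of_apply]
    field_simp
  · ext a b
    simp only [P, Matrix.star_apply, Matrix.of_apply, star_mul', star_inv₀, star_natCast]
    rw [← starRingEnd_apply, ← starRingEnd_apply, ← AddChar.map_neg_eq_conj,
      ← AddChar.map_neg_eq_conj, neg_sub, ← mul_neg, neg_sub]
  · ext a b
    rw [Matrix.sum_apply]
    simp only [P, Matrix.of_apply]
    rw [← mul_sum, e.sum_comp (fun x => stdAddChar (x * (e a - e b))),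
      AddChar.sum_mulShift _ (isPrimitive_stdAddChar n), Matrix.one_apply]
    by_cases h : a = b
    · subst h; simp [hn0]
    · simp [h, sub_eq_zero]
  · rw [cayleyZ4, SimpleGraph.addCayley_adj'] at hvw
    obtain ⟨-, g, hg, h⟩ := hvw
    have hz : ∑ b, stdAddChar (w b - v b) = 0 := by
      rcases h with rfl | rfl
      · simpa using sum_stdAddChar_eq_zero hg
      · have := congrArg conj (sum_stdAddChar_eq_zero hg)
        rw [map_sum, map_zero] at this
        simpa [← AddChar.map_neg_eq_conj] using this
    ext a c
    rw [hmul, hz, mul_zero, Matrix.zero_apply]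

end FourierColoring

/-! ### The chromatic number and the two regimes -/

theorem quantumChromaticNumber_cayleyZ4 {n r s : ℕ} (hn : n = 2 * (r + s)) (hn0 : 0 < n)
    (hr : Even r) (hkraw : ∀ k ≤ n, -(n.choose (2 * s) : ℤ) ≤ (n - 1) * kraw n k (2 * s)) :
    quantumChromaticNumber (cayleyZ4 n r s) = n := by
  refine le_antisymm (iInf_le (fun c : {c : ℕ // QuantumColorable (cayleyZ4 n r s) c} =>
    ((c : ℕ) : ℕ∞)) ⟨n, quantumColorable_cayleyZ4 r s hn0⟩) (le_iInf ?_)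
  rintro ⟨c, d, ⟨Q⟩⟩
  have hcard : 0 < (connectionSet n r s).card := by
    have h : (0 : ℤ) < (connectionSet n r s).card := by
      rw [card_connectionSet_middle hn]
      have h1 := Nat.choose_pos (show s ≤ r + s by omega)
      have h2 := Nat.choose_pos (show r + s ≤ n by omega)
      positivity
    exact_mod_cast h
  refine Nat.cast_le.2 (le_of_quantumColoring hcard (fun v u hu => ?_)
    (neg_card_le_re_sum_addChar hn hr hkraw) Q)
  have hu' : u ∈ vectorsOfType n r s r s := by
    classical
    simpa [connectionSet] using hu
  rw [cayleyZ4, SimpleGraph.addCayley_adj']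
  refine ⟨fun h => ?_, u, hu', Or.inl rfl⟩
  have hu0 : u = 0 := by simpa using h
  subst hu0
  have h0 := hu'.1
  simp [hammingWt] at h0
  omega

theorem mainTheorem2 :
    (∀ s : ℕ, 2 ≤ s → ∃ N : ℕ, ∀ n r : ℕ, n = 2 * (r + s) → s ≤ r → Even r → N ≤ n →
      quantumChromaticNumber (cayleyZ4 n r s) = n) ∧
    (∃ N : ℕ, ∀ α : ℝ, 0 < α → α ≤ 0.17 →
      ∀ n r s : ℕ, n = 2 * (r + s) → s ≤ r → Even r → (s : ℝ) = α * ((n : ℝ) / 2) → N ≤ n →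
        quantumChromaticNumber (cayleyZ4 n r s) = n) := by
  obtain ⟨N, hN⟩ := exists_neg_choose_le_kraw
  have key : ∀ n r s : ℕ, n = 2 * (r + s) → Even r → 1 ≤ s → 2 * (s : ℝ) ≤ 0.17 * n → N ≤ n →
      quantumChromaticNumber (cayleyZ4 n r s) = n := by
    intro n r s hn hr hs hsn hNn
    refine quantumChromaticNumber_cayleyZ4 hn (by omega) hr fun k hk => ?_
    exact hN n (2 * s) k hNn (by omega) (even_two_mul s) (by push_cast; exact hsn) hk
  -- `n ≥ 12 s` suffices for `2s ≤ 0.17 n`, since `0.17 · 12 = 2.04`.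
  refine ⟨fun s hs => ⟨max N (12 * s), fun n r hn _ hr hNn => ?_⟩,
    max N 1, fun α hα hα' n r s hn _ hr hs hNn => ?_⟩
  · refine key n r s hn hr (by omega) ?_ ((le_max_left _ _).trans hNn)
    have : 12 * (s : ℝ) ≤ n := by exact_mod_cast (le_max_right _ _).trans hNn
    linarith
  · have hnR : (0 : ℝ) < n := by exact_mod_cast (le_max_right N 1).trans hNn
    refine key n r s hn hr ?_ ?_ ((le_max_left _ _).trans hNn)
    · have : (0 : ℝ) < s := by rw [hs]; positivity
      exact_mod_cast this
    · rw [hs]; nlinarith
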